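/- A streaming algorithm consists of a buffer size function $\beta:\{-1\}\cup\mathbb N\to\mathbb N$ with $\beta(-1)=1$ (here $\mathbb N=\{0,1,2,\dots\}$), arbitrary update maps $u^{(t)}:\mathbb R^{\beta(t-1)}\times\mathbb R\to\mathbb R^{\beta(t)}$ and arbitrary output maps $m^{(t)}:\mathbb R^{\beta(t)}\to\mathbb R$ for $t\in\mathbb N$. On a stream $z=(z_0,z_1,\dots)\in\mathbb R^{\mathbb N}$ its states are $s^{(-1)}=0$ and $s^{(t)}=u^{(t)}(s^{(t-1)},z_t)$, and it is required that for every $t\in\mathbb N$ the map $\mathbb R^{t+1}\to\mathbb R^{\beta(t)}$, $(z_0,\dots,z_t)\mapsto s^{(t)}$, is continuous (the output maps need not be continuous). The algorithm computes a matrix $M\in\mathbb R^{\mathbb N\times\mathbb N}$ correctly up to time $\tau\in\mathbb N\cup\{\infty\}$ if $m^{(t)}(s^{(t)})=(Mz)_t=\sum_j M_{t,j}z_j$ for every stream $z$ and every $t\in\mathbb N$ with $t\le\tau$. For $t\le\tau$, let $\mathsf{space}_M(t;\tau)$ be the minimum $b$ such that some streaming algorithm computes $M$ correctly up to time $\tau$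 and has $\beta(t')\le b$ for all $0\le t'\le t$. For a generating function $G(x)=\sum_{k\ge0}a_kx^k$ with real coefficients, let $\mathsf{space}_G=\mathsf{space}_{T}$, where $T$ is the lower-triangular Toeplitz matrix with $T_{i,j}=a_{i-j}$ for $i\ge j$ and $T_{i,j}=0$ for $i<j$. **Theorem.** Let $G_{1/2}(x)=\frac1{\sqrt{1-x}}=\sum_{k\ge0}2^{-2k}\binom{2k}{k}x^k$. For every $t\in\mathbb N$, $$\mathsf{space}_{G_{1/2}}(t;2t)=t+1.$$ -/

import Mathlib

/-- The data of a streaming algorithm over `ℝ`: a buffer size for every time in `{-1, 0, 1, …}`,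
with size `1` at time `-1`, together with update and output maps.
Times are shifted by one: `buf k` is the buffer size `β (k - 1)`. -/
structure StreamingMaps where
  /-- `buf k` is the number of reals stored at time `k - 1`. -/
  buf : ℕ → ℕ
  buf_zero : buf 0 = 1
  /-- `update t` is `u⁽ᵗ⁾`: it maps the state at time `t - 1` and `z_t` to the state at time `t`. -/
  update : (t : ℕ) → (Fin (buf t) → ℝ) → ℝ → (Fin (buf (t + 1)) → ℝ)
  /-- `output t` is `m⁽ᵗ⁾`: it reads the state at time `t`. -/
  output : (t : ℕ) → (Fin (buf (t + 1)) → ℝ) → ℝ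

namespace StreamingMaps

/-- The buffer size `β t` at time `t ≥ 0`. -/
def bufferSize (A : StreamingMaps) (t : ℕ) : ℕ := A.buf (t + 1)

/-- The state after the first `k` inputs `z_0, …, z_{k-1}`, that is, at time `k - 1`.
The state at time `-1` is `0`. -/
def state (A : StreamingMaps) : (k : ℕ) → (Fin k → ℝ) → (Fin (A.buf k) → ℝ)
  | 0, _ => 0
  | k + 1, z => A.update k (A.state k (fun i => z i.castSucc)) (z (Fin.last k))

end StreamingMaps

/-- A streaming algorithm: for every `t` the map `(z_0, …, z_t) ↦ s⁽ᵗ⁾` is continuous.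
The output maps need not be continuous. -/
structure StreamingAlgorithm extends StreamingMaps where
  continuous_state : ∀ t : ℕ, Continuous (toStreamingMaps.state (t + 1))

/-- The output of the algorithm at time `t` on the stream `z`. -/
def StreamingAlgorithm.outputAt (A : StreamingAlgorithm) (z : ℕ → ℝ) (t : ℕ) : ℝ :=
  A.output t (A.state (t + 1) (fun i => z i))

/-- The algorithm computes `M` correctly up to time `τ` (which may be `∞`): on every stream `z`
and at every time `t ≤ τ` the output is `(M z)_t = ∑ j, M_{t,j} z_j`. -/
def StreamingAlgorithm.ComputesUpTo (A : StreamingAlgorithm) (M : Matrix ℕ ℕ ℝ) (τ : ℕ∞) : Prop :=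
  ∀ (z : ℕ → ℝ) (t : ℕ), (t : ℕ∞) ≤ τ → HasSum (fun j => M t j * z j) (A.outputAt z t)

/-- The space complexity `space_M(t; τ)`: the least `b` such that some streaming algorithm that
computes `M` correctly up to time `τ` has buffer sizes at most `b` at all times `t' ≤ t`
(and `∞` if there is no such algorithm). -/
noncomputable def space (M : Matrix ℕ ℕ ℝ) (t : ℕ) (τ : ℕ∞) : ℕ∞ :=
  sInf {b : ℕ∞ | ∃ A : StreamingAlgorithm, A.ComputesUpTo M τ ∧
    ∀ t' : ℕ, t' ≤ t → (A.bufferSize t' : ℕ∞) ≤ b}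

/-- The lower-triangular Toeplitz matrix of a sequence. -/
def toeplitz (a : ℕ → ℝ) : Matrix ℕ ℕ ℝ :=
  Matrix.of fun i j => if j ≤ i then a (i - j) else 0

/-- The space complexity of the sequence of coefficients of a generating function. -/
noncomputable def spaceOfSeries (G : PowerSeries ℝ) (t : ℕ) (τ : ℕ∞) : ℕ∞ :=
  space (toeplitz fun k => PowerSeries.coeff k G) t τ

/-- The generating function `G_{1/2}(x) = ∑ 2^{-2k} (2k choose k) x^k = 1 / √(1 - x)`. -/
noncomputable def Ghalf : PowerSeries ℝ :=
  PowerSeries.mk fun k => ((2 * k).choose k : ℝ) / 2 ^ (2 * k)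

/-- `G_{1/2}` is the power series `1 / √(1 - x)`: its square is the inverse of `1 - x`
and its constant coefficient is `1`. -/
theorem Ghalf_spec : Ghalf ^ 2 * (1 - PowerSeries.X) = 1 ∧ PowerSeries.constantCoeff Ghalf = 1 := by
  have hc : PowerSeries.constantCoeff Ghalf = 1 := by
    rw [← PowerSeries.coeff_zero_eq_constantCoeff_apply]
    simp [Ghalf]
  have hd : 2 * (1 - PowerSeries.X) * PowerSeries.derivative ℝ Ghalf = Ghalf := by
    have h : ∀ n : ℕ, PowerSeries.coeff n (PowerSeries.derivative ℝ Ghalf) =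
        (2 * n + 1) / 2 * PowerSeries.coeff n Ghalf := by
      intro n
      have h1 : ((n : ℝ) + 1) * ((2 * (n + 1)).choose (n + 1) : ℕ) =
          2 * (2 * n + 1) * ((2 * n).choose n : ℕ) := by
        have := Nat.succ_mul_centralBinom_succ n
        rw [Nat.centralBinom_eq_two_mul_choose, Nat.centralBinom_eq_two_mul_choose] at this
        exact_mod_cast this
      have h2 : (2 : ℝ) ^ (2 * (n + 1)) = 4 * 2 ^ (2 * n) := by ring
      rw [PowerSeries.coeff_derivative]
      simp only [Ghalf, PowerSeries.coeff_mk]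
      rw [h2, div_mul_eq_mul_div, div_eq_iff (by positivity), mul_comm, h1]
      field_simp
      ring
    ext n
    have e : 2 * (1 - PowerSeries.X) * PowerSeries.derivative ℝ Ghalf =
        (2 : ℝ) • (PowerSeries.derivative ℝ Ghalf - PowerSeries.X * PowerSeries.derivative ℝ Ghalf) := by
      rw [two_smul]; ring
    rw [e, PowerSeries.coeff_smul, map_sub, h]
    cases n with
    | zero => simp
    | succ n =>
      rw [PowerSeries.coeff_succ_X_mul, PowerSeries.coeff_derivative, smul_eq_mul]
      push_cast
      ring
  refine ⟨?_, hc⟩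
  apply PowerSeries.derivative.ext
  · rw [Derivation.leibniz, Derivation.leibniz_pow]
    simp only [map_sub, smul_eq_mul, Derivation.map_one_eq_zero, PowerSeries.derivative_X]
    norm_num
    linear_combination Ghalf * hd
  · simp [hc]

/-! Storing the whole input gives the upper bound. For the lower bound, feed zeros after time `t`:
the outputs at times `t, …, 2t` depend only on the state at time `t`, and they are the Hankel matrix
`(a_{i+j})` applied to the reversed prefix. The `a_k` are the moments of the arcsine distribution,
which has infinite support, so this matrix is positive definite and the prefix is determined by the
state. The state is thus a continuous injective function of `t + 1` reals, and invariance of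
dimension (`finrank_le_of_continuous_injective`) forces at least `t + 1` coordinates.

Invariance of dimension is proved analytically. Smoothing an injection into a smaller space and a
left inverse of it gives a `C¹` map close to the identity whose Jacobian vanishes everywhere; the
degree identity `integral_pow_mul_det_perturbation` excludes this. -/

/-! ### Invariance of dimension by integration. -/

/-- Polynomial dependence on `s` is what carries the change of variables formula from small `s` to
`s = 1`. -/
theorem ContinuousLinearMap.exists_polynomial_eval_eq_det_one_add_smul {E : Type*}
    [NormedAddCommGroup E] [NormedSpace ℝ E] [FiniteDimensional ℝ E] (A : E →L[ℝ] E) :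
    ∃ P : Polynomial ℝ, P.natDegree ≤ Module.finrank ℝ E ∧
      ∀ s : ℝ, P.eval s = (1 + s • A).det := by
  let b := Module.finBasis ℝ E
  let M := LinearMap.toMatrix b b (A : E →ₗ[ℝ] E)
  refine ⟨Matrix.det ((Polynomial.X : Polynomial ℝ) • M.map Polynomial.C +
    (1 : Matrix _ _ ℝ).map Polynomial.C), ?_, fun s => ?_⟩
  · simpa using Polynomial.natDegree_det_X_add_C_le M 1
  · rw [ContinuousLinearMap.det, ← LinearMap.det_toMatrix b, ← Polynomial.coe_evalRingHom,
      RingHom.map_det]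
    congr 1
    have h : LinearMap.toMatrix b b ((1 + s • A : E →L[ℝ] E) : E →ₗ[ℝ] E) = 1 + s • M := by
      simp [M, LinearMap.toMatrix_one]
    rw [h]
    ext i j
    simp only [Matrix.add_apply, Matrix.smul_apply, Matrix.map_apply, smul_eq_mul,
      RingHom.mapMatrix_apply, Polynomial.coe_evalRingHom, Polynomial.eval_add, Polynomial.eval_mul,
      Polynomial.eval_X, Polynomial.eval_C]
    ring

theorem Polynomial.eval_eq_sum_lagrange {P : Polynomial ℝ} {s : Finset ℝ} (hP : P.natDegree < s.card)
    (x : ℝ) : P.eval x = ∑ c ∈ s, (Lagrange.basis s id c).eval x * P.eval c := by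
  have h := Lagrange.eq_interpolate (s := s) (v := id) (f := P) (Set.injOn_id _)
    (lt_of_le_of_lt P.degree_le_natDegree (by exact_mod_cast hP))
  conv_lhs => rw [h]
  simp [Lagrange.interpolate_apply, Polynomial.eval_finsetSum, mul_comm]

open MeasureTheory in
/-- A compactly supported `C¹` perturbation of the identity maps a ball onto itself with
degree one, in integral form. -/
theorem integral_pow_mul_det_perturbation {E : Type*} [NormedAddCommGroup E]
    [InnerProductSpace ℝ E] [FiniteDimensional ℝ E] [MeasurableSpace E] [BorelSpace E] {ψ : E → E} (hψ : ContDiff ℝ 1 ψ) {R : ℝ}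
    (hsupp : ∀ x, R ≤ ‖x‖ → ψ x = 0) (c : ℝ) (k : ℕ) :
    ∫ x in Metric.ball (0 : E) R,
      (c - ‖x + ψ x‖ ^ 2) ^ k * (1 + fderiv ℝ ψ x).det =
    ∫ x in Metric.ball (0 : E) R, (c - ‖x‖ ^ 2) ^ k := by
  set I : ℝ → E → ℝ := fun s x => (c - ‖x + s • ψ x‖ ^ 2) ^ k * (1 + s • fderiv ℝ ψ x).det with hI
  have hcs : HasCompactSupport ψ := HasCompactSupport.intro (isCompact_closedBall (0 : E) R) (by
    intro x hx
    apply hsupp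
    simp at hx
    exact hx.le)
  obtain ⟨K, hK⟩ := hψ.lipschitzWith_of_hasCompactSupport hcs one_ne_zero
  have hdet : Continuous fun A : E →L[ℝ] E => A.det := ContinuousLinearMap.continuous_det
  have hint : ∀ s, IntegrableOn (I s) (Metric.ball 0 R) := by
    intro s
    have h1 : Continuous (fderiv ℝ ψ) := hψ.continuous_fderiv one_ne_zero
    have h2 := hψ.continuous
    have : Continuous (I s) := by
      refine Continuous.mul (by fun_prop) (hdet.comp (by fun_prop))
    exact (this.continuousOn.integrableOn_compact (isCompact_closedBall 0 R)).mono_set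
      Metric.ball_subset_closedBall
  -- small perturbations are diffeomorphisms
  have hsmall : ∃ ε > 0, ∀ s, 0 < s → s < ε → ∫ x in Metric.ball (0 : E) R, I s x =
      ∫ x in Metric.ball (0 : E) R, (c - ‖x‖ ^ 2) ^ k := by
    have hpos : ∀ᶠ A : E →L[ℝ] E in nhds 1, 0 < A.det := by
      refine hdet.continuousAt.eventually (lt_mem_nhds ?_)
      simp [ContinuousLinearMap.det]
    obtain ⟨δ, hδ, hball⟩ := Metric.eventually_nhds_iff.1 hpos
    -- `s * K < 1` makes `x ↦ x + s • ψ x` bijective; `s * K < δ` keeps its Jacobian determinant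
    -- positive.
    refine ⟨min δ 1 / (K + 1), by positivity, fun s hs hsε => ?_⟩
    have hsK : s * K < min δ 1 := by
      rw [lt_div_iff₀ (by positivity)] at hsε
      nlinarith
    have hlip : ∀ x y, ‖s • ψ x - s • ψ y‖ ≤ s * K * ‖x - y‖ := by
      intro x y
      rw [← smul_sub, norm_smul, Real.norm_of_nonneg hs.le, mul_assoc]
      gcongr
      exact hK.norm_sub_le x y
    have happ : ApproximatesLinearOn (fun x => x + s • ψ x)
        ((ContinuousLinearEquiv.refl ℝ E : E ≃L[ℝ] E) : E →L[ℝ] E) Set.univ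
        (s.toNNReal * K) := by
      intro x _ y _
      have := hlip x y
      convert this using 2
      · simp only [ContinuousLinearEquiv.coe_coe, ContinuousLinearEquiv.coe_refl', id]
        abel
      · simp [hs.le]
    have hc' : Subsingleton E ∨ (s.toNNReal * K) <
        ‖((ContinuousLinearEquiv.refl ℝ E).symm : E →L[ℝ] E)‖₊⁻¹ := by
      rcases subsingleton_or_nontrivial E with h | h
      · exact Or.inl h
      · right
        rw [← NNReal.coe_lt_coe]
        simp only [NNReal.coe_mul, Real.coe_toNNReal _ hs.le]
        simpa using hsK.trans_le (min_le_right _ _)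
    have hinj : Function.Injective (fun x => x + s • ψ x) := by
      simpa [Set.injOn_univ] using happ.injOn hc'
    have hsurj : Function.Surjective (fun x => x + s • ψ x) := happ.surjective hc'
    -- A bijection fixing every point outside the ball must preserve the ball.
    have himg : (fun x => x + s • ψ x) '' Metric.ball 0 R = Metric.ball 0 R := by
      have hfix : ∀ x : E, R ≤ ‖x‖ → x + s • ψ x = x := fun x hx => by simp [hsupp x hx]
      ext y
      simp only [Set.mem_image, mem_ball_zero_iff]
      constructor
      · rintro ⟨x, hx, rfl⟩
        by_contra! h
        have : x + s • ψ x = x := hinj (hfix _ h)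
        rw [this] at h
        exact absurd hx h.not_gt
      · intro hy
        obtain ⟨x, rfl⟩ := hsurj y
        refine ⟨x, ?_, rfl⟩
        by_contra! h
        have := hfix x h
        simp only [this] at hy
        exact absurd hy h.not_gt
    have hderiv : ∀ x ∈ Metric.ball (0 : E) R, HasFDerivWithinAt (fun x => x + s • ψ x)
        (1 + s • fderiv ℝ ψ x) (Metric.ball 0 R) x := by
      intro x _
      have h1 : HasFDerivAt ψ (fderiv ℝ ψ x) x :=
        ((hψ.differentiable one_ne_zero) x).hasFDerivAt
      exact ((hasFDerivAt_id x).add (h1.const_smul s)).hasFDerivWithinAt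
    have hchg := integral_image_eq_integral_abs_det_fderiv_smul (volume : Measure E)
      measurableSet_ball hderiv hinj.injOn (fun x => (c - ‖x‖ ^ 2) ^ k)
    rw [himg] at hchg
    rw [hchg]
    refine setIntegral_congr_fun measurableSet_ball fun x _ => ?_
    have : 0 < (1 + s • fderiv ℝ ψ x).det := by
      apply hball
      rw [dist_eq_norm, add_sub_cancel_left, norm_smul, Real.norm_of_nonneg hs.le]
      refine lt_of_le_of_lt ?_ (hsK.trans_le (min_le_left _ _))
      gcongr
      exact norm_fderiv_le_of_lipschitz ℝ hK
    simp only [hI, abs_of_pos this, smul_eq_mul]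
    ring
  obtain ⟨ε, hε, hsm⟩ := hsmall
  -- The integrand has degree at most `finrank + 2k` in `s`, so its value at `s = 1` is interpolated
  -- from this many nodes in `(0, ε)`, where the integral is already known.
  obtain ⟨S, hS, hScard⟩ := (Set.Ioo_infinite hε).exists_subset_card_eq (Module.finrank ℝ E + 2 * k + 1)
  have hpoly : ∀ (x : E) (t : ℝ), I t x = ∑ s ∈ S, (Lagrange.basis S id s).eval t * I s x := by
    intro x t
    obtain ⟨P, hPd, hP⟩ :=
      (fderiv ℝ ψ x).exists_polynomial_eval_eq_det_one_add_smul
    set Q : Polynomial ℝ := (Polynomial.C (-‖ψ x‖ ^ 2) * Polynomial.X ^ 2 +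
      Polynomial.C (-2 * inner ℝ x (ψ x)) * Polynomial.X + Polynomial.C (c - ‖x‖ ^ 2)) ^ k * P with hQ
    have hQd : Q.natDegree < S.card := by
      have h1 : Q.natDegree ≤ k * 2 + Module.finrank ℝ E := by
        refine Polynomial.natDegree_mul_le.trans (add_le_add ?_ hPd)
        refine Polynomial.natDegree_pow_le.trans (Nat.mul_le_mul_left _ ?_)
        exact Polynomial.natDegree_quadratic_le
      omega
    have hQe : ∀ s, Q.eval s = I s x := by
      intro s
      simp only [hQ, hI, Polynomial.eval_mul, hP, Polynomial.eval_pow, Polynomial.eval_add,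
        Polynomial.eval_C, Polynomial.eval_X]
      congr 2
      rw [norm_add_sq_real, inner_smul_right, norm_smul, mul_pow, Real.norm_eq_abs, sq_abs]
      ring
    simp only [← hQe]
    exact Polynomial.eval_eq_sum_lagrange hQd t
  have h1 : ∫ x in Metric.ball (0 : E) R, I 1 x = ∑ s ∈ S, (Lagrange.basis S id s).eval 1 *
      ∫ x in Metric.ball (0 : E) R, (c - ‖x‖ ^ 2) ^ k := by
    simp_rw [hpoly _ 1]
    rw [integral_finsetSum _ fun s _ => (hint s).const_mul _]
    refine Finset.sum_congr rfl fun s hs => ?_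
    rw [integral_const_mul, hsm s (hS hs).1 (hS hs).2]
  have h2 : ∑ s ∈ S, (Lagrange.basis S id s).eval (1 : ℝ) = 1 := by
    have := Polynomial.eval_eq_sum_lagrange (P := 1) (s := S) (by simp [hScard]) 1
    simpa using this.symm
  rw [← Finset.sum_mul, h2, one_mul] at h1
  simpa [hI] using h1

open MeasureTheory Metric in
/-- A `C¹` map that is uniformly close to the identity on a ball has a nonzero Jacobian
somewhere. -/
theorem exists_det_fderiv_ne_zero_of_dist_id_le {E : Type*} [NormedAddCommGroup E]
    [InnerProductSpace ℝ E] [FiniteDimensional ℝ E] {F : E → E} (hF : ContDiff ℝ 1 F)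
    (hclose : ∀ x, ‖x‖ ≤ 2 → ‖F x - x‖ ≤ 1 / 2) : ∃ x, (fderiv ℝ F x).det ≠ 0 := by
  by_contra! hdet
  let : MeasurableSpace E := borel E
  have : BorelSpace E := ⟨rfl⟩
  let φ : ContDiffBump (0 : E) := ⟨1, 2, one_pos, one_lt_two⟩
  let ψ : E → E := fun x => φ x • (F x - x)
  have hψ : ContDiff ℝ 1 ψ := φ.contDiff.smul (hF.sub contDiff_id)
  have hsupp : ∀ x, 2 ≤ ‖x‖ → ψ x = 0 := fun x hx => by
    simp [ψ, φ.zero_of_le_dist (by simpa using hx)]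
  have hψle : ∀ x, ‖x‖ ≤ 2 → ‖ψ x‖ ≤ 1 / 2 := fun x hx => by
    rw [norm_smul, Real.norm_of_nonneg φ.nonneg]
    exact (mul_le_of_le_one_left (norm_nonneg _) φ.le_one).trans (hclose x hx)
  -- On the unit ball the cutoff is `1`, so `id + ψ` coincides with `F` there.
  have hinner : ∀ x ∈ ball (0 : E) 1, (1 + fderiv ℝ ψ x).det = 0 := by
    intro x hx
    have he : ψ =ᶠ[nhds x] fun y => F y - y := by
      filter_upwards [isOpen_ball.mem_nhds hx] with y hy
      simp [ψ, φ.one_of_mem_closedBall (ball_subset_closedBall hy)]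
    have hd : fderiv ℝ ψ x = fderiv ℝ F x - 1 := by
      rw [he.fderiv_eq]
      exact ((hF.differentiable one_ne_zero x).hasFDerivAt.sub (hasFDerivAt_id x)).fderiv
    rw [hd, add_sub_cancel]
    exact hdet x
  have hdc : Continuous fun x => (1 + fderiv ℝ ψ x).det :=
    ContinuousLinearMap.continuous_det.comp
      (continuous_const.add (hψ.continuous_fderiv one_ne_zero))
  have hint : ∀ {f : E → ℝ}, Continuous f → ∀ r, IntegrableOn f (ball 0 r) := fun hf r =>
    (hf.continuousOn.integrableOn_compact (isCompact_closedBall 0 r)).mono_set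
      ball_subset_closedBall
  set C := ∫ x in ball (0 : E) 2, |(1 + fderiv ℝ ψ x).det| with hC
  set V := volume.real (ball (0 : E) (1 / 4)) with hV
  have hVpos : 0 < V :=
    ENNReal.toReal_pos (measure_ball_pos _ _ (by norm_num)).ne' measure_ball_lt_top.ne
  -- The weight `(4 - ‖·‖²)^k` peaks at the origin, which `id + ψ` avoids wherever its Jacobian is
  -- nonzero. The unperturbed integral is at least its part over radius `1/4`, where the base is at
  -- least `4 - 1/16 = 63/16`. In the perturbed one only `1 ≤ ‖x‖ < 2` contributes; there `1/2 ≤ ‖x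
  -- + ψ x‖ ≤ 5/2`, so the base is at most `4 - 1/4 = 15/4` in absolute value. Large `k` gives a
  -- contradiction.
  have hmain : ∀ k : ℕ, (63 / 16 : ℝ) ^ k * V ≤ (15 / 4) ^ k * C := by
    intro k
    have hk := integral_pow_mul_det_perturbation hψ hsupp 4 k
    have hlow : (63 / 16 : ℝ) ^ k * V ≤ ∫ x in ball (0 : E) 2, (4 - ‖x‖ ^ 2) ^ k := by
      have hcont : Continuous fun x : E => (4 - ‖x‖ ^ 2) ^ k := by fun_prop
      calc (63 / 16 : ℝ) ^ k * V = ∫ x in ball (0 : E) (1 / 4), (63 / 16 : ℝ) ^ k := by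
            rw [setIntegral_const, smul_eq_mul, mul_comm]
        _ ≤ ∫ x in ball (0 : E) (1 / 4), (4 - ‖x‖ ^ 2) ^ k := by
            refine setIntegral_mono_on (hint continuous_const _) (hint hcont _)
              measurableSet_ball fun x hx => ?_
            rw [mem_ball_zero_iff] at hx
            gcongr
            nlinarith [norm_nonneg x]
        _ ≤ ∫ x in ball (0 : E) 2, (4 - ‖x‖ ^ 2) ^ k := by
            refine setIntegral_mono_set (hint hcont _) ?_
              (ball_subset_ball (by norm_num)).eventuallyLE
            filter_upwards [ae_restrict_mem measurableSet_ball] with x hx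
            rw [mem_ball_zero_iff] at hx
            have : 0 ≤ 4 - ‖x‖ ^ 2 := by nlinarith [norm_nonneg x]
            exact pow_nonneg this k
    refine hlow.trans ?_
    rw [← hk, hC, ← integral_const_mul]
    have hψc := hψ.continuous
    refine setIntegral_mono_on (hint (Continuous.mul (by fun_prop) hdc) _)
      (hint (continuous_const.mul hdc.abs) _) measurableSet_ball fun x hx => ?_
    rw [mem_ball_zero_iff] at hx
    rcases lt_or_ge ‖x‖ 1 with h1 | h1
    · simp [hinner x (by simpa using h1)]
    · have hp := hψle x hx.le
      have hup : ‖x + ψ x‖ ≤ 5 / 2 := (norm_add_le _ _).trans (by linarith)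
      have hlo : 1 / 2 ≤ ‖x + ψ x‖ := by
        have := norm_sub_le (x + ψ x) (ψ x)
        rw [add_sub_cancel_right] at this
        linarith
      refine (le_abs_self _).trans ?_
      rw [abs_mul, abs_pow]
      gcongr
      rw [abs_le]
      constructor <;> nlinarith
  have hlim : Filter.Tendsto (fun k : ℕ => (20 / 21 : ℝ) ^ k * C) Filter.atTop (nhds 0) := by
    simpa using (tendsto_pow_atTop_nhds_zero_of_lt_one (r := (20 / 21 : ℝ))
      (by norm_num) (by norm_num)).mul_const C
  obtain ⟨k, hk⟩ := (hlim.eventually (gt_mem_nhds hVpos)).exists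
  have h := hmain k
  have he : (15 / 4 : ℝ) ^ k = (63 / 16) ^ k * (20 / 21) ^ k := by
    rw [← mul_pow]
    norm_num
  rw [he, mul_assoc] at h
  exact absurd (le_of_mul_le_mul_left h (by positivity)) hk.not_ge

theorem ContinuousLinearMap.det_comp_eq_zero_of_finrank_lt {E E' : Type*} [NormedAddCommGroup E]
    [NormedSpace ℝ E] [NormedAddCommGroup E'] [NormedSpace ℝ E'] [FiniteDimensional ℝ E]
    [FiniteDimensional ℝ E'] (h : Module.finrank ℝ E' < Module.finrank ℝ E) (A : E' →L[ℝ] E)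
    (B : E →L[ℝ] E') : (A.comp B).det = 0 := by
  rw [ContinuousLinearMap.det]
  exact LinearMap.det_eq_zero_iff_ker_ne_bot.2 fun hker =>
    LinearMap.ker_ne_bot_of_finrank_lt h (eq_bot_iff.2 ((LinearMap.ker_le_ker_comp
      (B : E →ₗ[ℝ] E') (A : E' →ₗ[ℝ] E)).trans hker.le))

/-- **Invariance of dimension**: there is no continuous injective map into a space of smaller
dimension. -/
theorem finrank_le_of_continuous_injective {E E' : Type*} [NormedAddCommGroup E]
    [InnerProductSpace ℝ E] [FiniteDimensional ℝ E] [NormedAddCommGroup E'] [NormedSpace ℝ E']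
    [FiniteDimensional ℝ E'] {h : E → E'} (hc : Continuous h) (hi : Function.Injective h) :
    Module.finrank ℝ E ≤ Module.finrank ℝ E' := by
  by_contra! hlt
  set K := Metric.closedBall (0 : E) 2
  have hK : IsCompact K := isCompact_closedBall _ _
  have : CompactSpace K := isCompact_iff_compactSpace.1 hK
  have he : Topology.IsClosedEmbedding fun x : K => h x :=
    (hc.comp continuous_subtype_val).isClosedEmbedding (hi.comp Subtype.val_injective)
  -- Tietze extension of the inverse of `h` on the compact ball `K`.
  obtain ⟨g, hg⟩ := ContinuousMap.exists_extension' he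
    (⟨Subtype.val, continuous_subtype_val⟩ : C(K, E))
  obtain ⟨g', hg', hgg', -⟩ := g.continuous.exists_contDiff_approx 1 (ε := fun _ => 1 / 4)
    continuous_const (fun _ => by norm_num)
  -- `g'` is fixed before `h'`, so its continuity near the compact set `h '' K` dictates how closely
  -- `h'` must follow `h`. The two errors of `1/4` add up to the allowed `1/2`.
  obtain ⟨δ, hδ, hunif⟩ : ∃ δ > 0, ∀ x ∈ K, ∀ y, dist y (h x) < δ →
      dist (g' y) (g' (h x)) < 1 / 4 := by
    have h1 := (hK.image hc).uniformContinuousAt_of_continuousAt g'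
      (fun y _ => hg'.continuous.continuousAt)
      (Metric.dist_mem_uniformity (by norm_num : (0 : ℝ) < 1 / 4))
    obtain ⟨δ, hδ, h2⟩ := Metric.mem_uniformity_dist.1 h1
    refine ⟨δ, hδ, fun x hx y hy => ?_⟩
    rw [dist_comm] at hy ⊢
    exact h2 hy (Set.mem_image_of_mem h hx)
  obtain ⟨h', hh', hhh', -⟩ := hc.exists_contDiff_approx 1 (ε := fun _ => δ)
    continuous_const (fun _ => hδ)
  obtain ⟨x, hx⟩ := exists_det_fderiv_ne_zero_of_dist_id_le (hg'.comp hh') (by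
    intro x hx
    have hxK : x ∈ K := by simpa [K] using hx
    have h1 := hunif x hxK (h' x) (hhh' x)
    have h2 := hgg' (h x)
    have h3 : g (h x) = x := congrFun hg ⟨x, hxK⟩
    rw [h3] at h2
    rw [← dist_eq_norm]
    exact (dist_triangle _ (g' (h x)) _).trans (by simp only [Function.comp]; linarith))
  apply hx
  rw [fderiv_comp x (hg'.differentiable one_ne_zero _) (hh'.differentiable one_ne_zero _)]
  exact ContinuousLinearMap.det_comp_eq_zero_of_finrank_lt hlt _ _

/-! ### Arcsine moments and Hankel matrices. -/

theorem Nat.choose_two_mul_div_two_pow_eq_prod (k : ℕ) :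
    ((2 * k).choose k : ℝ) / 2 ^ (2 * k) =
      ∏ i ∈ Finset.range k, (2 * (i : ℝ) + 1) / (2 * i + 2) := by
  induction k with
  | zero => simp
  | succ k ih =>
    have h1 : ((k : ℝ) + 1) * ((2 * (k + 1)).choose (k + 1) : ℕ) =
        2 * (2 * k + 1) * ((2 * k).choose k : ℕ) := by
      have := Nat.succ_mul_centralBinom_succ k
      rw [Nat.centralBinom_eq_two_mul_choose, Nat.centralBinom_eq_two_mul_choose] at this
      exact_mod_cast this
    rw [Finset.prod_range_succ, ← ih, mul_add, pow_add]
    field_simp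
    linear_combination h1 * 2

/-- The coefficients of `1 / √(1 - x)` are the moments of the arcsine distribution. -/
theorem coeff_Ghalf_eq_integral (k : ℕ) :
    PowerSeries.coeff k Ghalf = Real.pi⁻¹ * ∫ x in (0 : ℝ)..Real.pi, Real.sin x ^ (2 * k) := by
  rw [integral_sin_pow_even, ← Nat.choose_two_mul_div_two_pow_eq_prod,
    inv_mul_cancel_left₀ Real.pi_ne_zero]
  simp [Ghalf]

/-- A continuous nonnegative integrand with zero integral vanishes identically, and `sin²` takes
every value in `[0, 1]`, so `p` has infinitely many roots. -/
theorem Polynomial.eq_zero_of_integral_eval_sin_sq_sq_eq_zero (p : Polynomial ℝ)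
    (h : ∫ x in (0 : ℝ)..Real.pi, p.eval (Real.sin x ^ 2) ^ 2 = 0) : p = 0 := by
  have hc : Continuous fun x : ℝ => p.eval (Real.sin x ^ 2) ^ 2 := by fun_prop
  have hz : ∀ x ∈ Set.Icc (0 : ℝ) Real.pi, p.eval (Real.sin x ^ 2) = 0 := by
    by_contra! hne
    obtain ⟨x, hx, hpx⟩ := hne
    refine (intervalIntegral.integral_pos Real.pi_pos hc.continuousOn
      (fun y _ => sq_nonneg _) ⟨x, hx, by positivity⟩).ne' h
  refine Polynomial.eq_zero_of_infinite_isRoot p ((Set.Icc_infinite zero_lt_one).mono ?_)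
  intro y hy
  have hx := hz (Real.arcsin (Real.sqrt y)) ⟨Real.arcsin_nonneg.2 (Real.sqrt_nonneg _),
    (Real.arcsin_le_pi_div_two _).trans (by linarith [Real.pi_pos])⟩
  rwa [Real.sin_arcsin (by linarith [Real.sqrt_nonneg y]) (Real.sqrt_le_one.2 hy.2),
    Real.sq_sqrt hy.1] at hx

/-- The Hankel matrices of the coefficients of `1 / √(1 - x)` have trivial kernel. -/
theorem eq_zero_of_hankel_Ghalf_mulVec_eq_zero {n : ℕ} (w : Fin n → ℝ)
    (hw : ∀ i : Fin n, ∑ j : Fin n, PowerSeries.coeff ((i : ℕ) + j) Ghalf * w j = 0) : w = 0 := by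
  -- With this `p`, the quadratic form `wᵀHw` equals `π⁻¹ ∫ p(sin² x)² dx`, so `Hw = 0` makes the
  -- integral vanish.
  set p : Polynomial ℝ := ∑ j : Fin n, Polynomial.C (w j) * Polynomial.X ^ (j : ℕ) with hp
  have hp0 : p = 0 := by
    apply Polynomial.eq_zero_of_integral_eval_sin_sq_sq_eq_zero
    have hexp : ∀ x : ℝ, p.eval (Real.sin x ^ 2) ^ 2 =
        ∑ i : Fin n, ∑ j : Fin n, w i * w j * Real.sin x ^ (2 * ((i : ℕ) + j)) := by
      intro x
      rw [sq, hp, Polynomial.eval_finsetSum, Finset.sum_mul_sum]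
      refine Finset.sum_congr rfl fun i _ => Finset.sum_congr rfl fun j _ => ?_
      simp only [Polynomial.eval_mul, Polynomial.eval_C, Polynomial.eval_pow, Polynomial.eval_X]
      ring
    simp_rw [hexp]
    rw [intervalIntegral.integral_finsetSum fun i _ =>
      Continuous.intervalIntegrable (by fun_prop) _ _]
    refine Finset.sum_eq_zero fun i _ => ?_
    rw [intervalIntegral.integral_finsetSum fun j _ =>
      Continuous.intervalIntegrable (by fun_prop) _ _]
    have := congrArg (fun r => Real.pi * w i * r) (hw i)
    simp only [coeff_Ghalf_eq_integral, Finset.mul_sum, mul_zero] at this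
    refine Eq.trans ?_ this
    refine Finset.sum_congr rfl fun j _ => ?_
    rw [intervalIntegral.integral_const_mul]
    field_simp [Real.pi_ne_zero]
  ext j
  have := congrArg (fun q => Polynomial.coeff q j) hp0
  simpa [hp, Polynomial.finsetSum_coeff, Polynomial.coeff_C_mul, Polynomial.coeff_X_pow,
    Fin.val_inj, Finset.sum_ite_eq] using this

/-! ### Streaming algorithms: the two bounds. -/

namespace StreamingMaps

theorem state_add_congr (A : StreamingMaps) {z w : ℕ → ℝ} {k : ℕ}
    (h : A.state k (fun i => z i) = A.state k (fun i => w i)) (hzw : ∀ i, k ≤ i → z i = w i)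
    (l : ℕ) : A.state (k + l) (fun i => z i) = A.state (k + l) (fun i => w i) := by
  induction l with
  | zero => exact h
  | succ l ih =>
    change A.update (k + l) (A.state (k + l) (fun i => z i)) (z (k + l)) =
      A.update (k + l) (A.state (k + l) (fun i => w i)) (w (k + l))
    rw [ih, hzw _ (Nat.le_add_right _ _)]

/-- The algorithm that stores its whole input. -/
def storeAll (out : (t : ℕ) → (Fin (t + 1) → ℝ) → ℝ) : StreamingMaps where
  -- Truncated subtraction gives size `1` both at time `-1` and at time `0`; the dummy initial entry
  -- is overwritten by the first update.
  buf k := k - 1 + 1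
  buf_zero := rfl
  update t s x := fun i : Fin (t + 1) =>
    if h : (i : ℕ) < t then s ⟨i, by omega⟩ else x
  output t s := out t s

theorem storeAll_state (out : (t : ℕ) → (Fin (t + 1) → ℝ) → ℝ) (t : ℕ) (z : Fin (t + 1) → ℝ) :
    (storeAll out).state (t + 1) z = z := by
  induction t with
  | zero =>
    funext i
    change z (Fin.last 0) = z i
    exact congrArg z (Subsingleton.elim (α := Fin 1) _ _)
  | succ t ih =>
    change (storeAll out).update (t + 1) ((storeAll out).state (t + 1) fun i => z i.castSucc)
      (z (Fin.last _)) = z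
    rw [ih]
    ext i
    change (if h : (i : ℕ) < t + 1 then _ else _) = _
    split_ifs with h
    · rfl
    · congr 1
      ext
      have := i.2
      change (t + 1 : ℕ) = (i : ℕ)
      change (i : ℕ) < t + 1 + 1 at this
      omega

end StreamingMaps

theorem hasSum_toeplitz_mul (a : ℕ → ℝ) (z : ℕ → ℝ) (t : ℕ) :
    HasSum (fun j => toeplitz a t j * z j) (∑ j ∈ Finset.range (t + 1), a (t - j) * z j) := by
  have h := hasSum_sum_of_ne_finset_zero (f := fun j => toeplitz a t j * z j)
    (s := Finset.range (t + 1)) (L := SummationFilter.unconditional ℕ) (by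
      intro j hj
      have : ¬ j ≤ t := by simpa [Nat.lt_succ_iff] using hj
      simp [toeplitz, this])
  convert h using 1
  refine Finset.sum_congr rfl fun j hj => ?_
  have : j ≤ t := by simpa [Nat.lt_succ_iff] using hj
  simp [toeplitz, this]

theorem space_toeplitz_le (a : ℕ → ℝ) (t : ℕ) (τ : ℕ∞) :
    space (toeplitz a) t τ ≤ ((t + 1 : ℕ) : ℕ∞) := by
  refine sInf_le ?_
  let M := StreamingMaps.storeAll fun t z => ∑ j : Fin (t + 1), a (t - j) * z j
  have hM : ∀ t, Continuous (M.state (t + 1)) := fun t => by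
    have : M.state (t + 1) = id := funext fun z => StreamingMaps.storeAll_state _ t z
    rw [this]
    exact continuous_id
  refine ⟨⟨M, hM⟩, fun z s _ => ?_, fun t' ht' => ?_⟩
  · have : StreamingAlgorithm.outputAt ⟨M, hM⟩ z s =
        ∑ j ∈ Finset.range (s + 1), a (s - j) * z j := by
      rw [StreamingAlgorithm.outputAt, Finset.sum_range]
      change ∑ j : Fin (s + 1), a (s - j) * M.state (s + 1) (fun i => z i) j = _
      rw [StreamingMaps.storeAll_state]
    rw [this]
    exact hasSum_toeplitz_mul a z s
  · have : M.bufferSize t' = t' + 1 := rfl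
    change ((M.bufferSize t' : ℕ) : ℕ∞) ≤ _
    rw [this]
    exact_mod_cast Nat.succ_le_succ ht'

/-- Two prefixes with the same state yield the same outputs on equal continuations. Continuing by
zeros up to time `2t` gives `t + 1` linear equations on the difference of the prefixes, with an
invertible Hankel matrix. -/
theorem StreamingAlgorithm.injective_state_of_computesUpTo_Ghalf (A : StreamingAlgorithm) (t : ℕ)
    (hA : A.ComputesUpTo (toeplitz fun k => PowerSeries.coeff k Ghalf) ((2 * t : ℕ) : ℕ∞)) :
    Function.Injective (A.toStreamingMaps.state (t + 1)) := by
  intro z w hzw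
  let ext0 : (Fin (t + 1) → ℝ) → ℕ → ℝ := fun z i => if h : i < t + 1 then z ⟨i, h⟩ else 0
  have hext : ∀ z, (fun i : Fin (t + 1) => ext0 z i) = z := fun z => by
    ext i
    simp only [ext0, dif_pos i.2]
  have hout : ∀ i ≤ t, A.outputAt (ext0 z) (t + i) = A.outputAt (ext0 w) (t + i) := by
    intro i _
    have h := A.state_add_congr (z := ext0 z) (w := ext0 w) (k := t + 1)
      (by rw [hext, hext, hzw]) (fun i hi => by simp only [ext0, dif_neg hi.not_gt]) i
    rw [add_right_comm] at h
    simp only [StreamingAlgorithm.outputAt, h]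
  -- Reversing the prefix turns the Toeplitz index `t + i - j` into the Hankel index `i + j`.
  have hsum : ∀ (v : Fin (t + 1) → ℝ) (i : ℕ), i ≤ t → A.outputAt (ext0 v) (t + i) =
      ∑ j : Fin (t + 1), PowerSeries.coeff (i + j) Ghalf * v j.rev := by
    intro v i hi
    rw [(hA (ext0 v) (t + i) (by exact_mod_cast (by omega))).unique (hasSum_toeplitz_mul _ _ _)]
    have : Finset.range (t + 1) ⊆ Finset.range (t + i + 1) := by
      intro j
      simp
      omega
    rw [← Finset.sum_subset this (fun j _ hj => by
      have : ¬ j < t + 1 := by simpa using hj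
      simp only [ext0, dif_neg this, mul_zero]), Finset.sum_range, ← Equiv.sum_comp Fin.revPerm]
    refine Finset.sum_congr rfl fun j _ => ?_
    have hj : t + i - ((Fin.revPerm j : Fin (t + 1)) : ℕ) = i + j := by
      rw [Fin.revPerm_apply, Fin.val_rev]
      omega
    rw [hj, congrFun (hext v) (Fin.revPerm j), Fin.revPerm_apply]
  have h0 := eq_zero_of_hankel_Ghalf_mulVec_eq_zero (fun j : Fin (t + 1) => z j.rev - w j.rev)
    (fun i => by
      have hi : (i : ℕ) ≤ t := Nat.lt_succ_iff.1 i.2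
      simp only [mul_sub, Finset.sum_sub_distrib]
      rw [← hsum z i hi, ← hsum w i hi, hout i hi, sub_self])
  ext j
  have := congrFun h0 j.rev
  simpa [sub_eq_zero] using this

theorem theorem3 (t : ℕ) :
    spaceOfSeries Ghalf t ((2 * t : ℕ) : ℕ∞) = ((t + 1 : ℕ) : ℕ∞) := by
  refine le_antisymm (space_toeplitz_le _ _ _) (le_sInf ?_)
  rintro b ⟨A, hA, hb⟩
  refine le_trans ?_ (hb t le_rfl)
  -- The domain passes through `EuclideanSpace` because the dimension theorem needs an inner product
  -- on the source.
  have h := finrank_le_of_continuous_injective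
    ((A.continuous_state t).comp (EuclideanSpace.equiv (Fin (t + 1)) ℝ).continuous)
    ((A.injective_state_of_computesUpTo_Ghalf t hA).comp
      (EuclideanSpace.equiv (Fin (t + 1)) ℝ).injective)
  simp only [finrank_euclideanSpace_fin, Module.finrank_fin_fun] at h
  exact_mod_cast h
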